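/- **Model.** Let $n\ge 1$ be the number of concepts, concept $1$ being the correct one. Let $a_1=1$ and let the overlaps $a_2,\dots,a_n\in[0,1]$ of the correct concept with the others be independent random variables with common probability density $\tilde f$ supported in $[0,1]$. Put $f(x)=\tilde f(1-x)$, the density of $x_i=1-a_i$. Given the overlaps, the memoryless learner is the Markov chain on $\{1,\dots,n\}$ with uniform initial distribution $\mathbf p^{(0)}=(1/n,\dots,1/n)^T$ and transition matrix $$T_{ii}=a_i,\qquad T_{ij}=\frac{1-a_i}{n-1}\quad(i\ne j).$$ For $0<\Delta<1$ let $N_\Delta=N_\Delta(n)$ be the least $N\ge 0$ such that the learner holds the correct concept after $N$ steps with probability at least $1-\Delta$, i.e. $[(\mathbf p^{(0)})^T T^N]_1\ge 1-\Delta$; it is a random variable, being a function of the overlaps. Below, $\mathbf P$ is the probability over the overlaps. **Theorem.** Suppose that $f(x)=c\,x^{\beta}+O(x^{\beta+\delta})$ as $x\to 0^+$, for some constants $c,\delta>0$ and a real $\beta$. 1. If $\beta>0$, then $N_\Delta\sim|\log\Delta|\,n$ in the following sense: there are constants $C_1,C_2>0$ such that for every $\Delta\in(0,1)$ $$\lim_{n\to\infty}\mathbf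 P\left(C_1<\frac{N_\Delta}{|\log\Delta|\,n}<C_2\right)=1,$$ and for each $\Delta_0\in(0,1)$ the convergence is uniform in $\Delta\in(0,\Delta_0]$. 2. If $-1<\beta<0$, then $N_\Delta/(|\log\Delta|\,n^{1/(1+\beta)})$ is tight in $(0,\infty)$: for every $\Delta_0\in(0,1)$, $$\lim_{x\to\infty}\mathbf P\left(\frac1x<\frac{N_\Delta}{|\log\Delta|\,n^{1/(1+\beta)}}<x\right)=1,$$ uniformly over all $\Delta\in(0,\Delta_0]$ and all $n$ with $1/n<1-\Delta_0$ (the latter condition says that the initial guess alone does not already succeed with probability $1-\Delta_0$, i.e. $N_{\Delta_0}\neq0$). -/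

import Mathlib

open MeasureTheory ProbabilityTheory Filter Topology Asymptotics Set

noncomputable section

/-- Transition matrix of the memoryless learner algorithm, when `a i` is the overlap of the correct
concept with concept `i` (the probability that an example given by the teacher is consistent with
concept `i`): a learner holding concept `i` keeps it with probability `a i`, and otherwise switches
to a uniformly chosen other concept. -/
def memorylessMatrix {ι : Type*} [Fintype ι] [DecidableEq ι] (a : ι → ℝ) : Matrix ι ι ℝ :=
  Matrix.of fun i j => if i = j then a i else (1 - a i) / ((Fintype.card ι : ℝ) - 1)

/-- The probability that, after `N` examples, the learner holds the concept `k`, when the initial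
guess is uniform: the `k`-th coordinate of the row vector `(1/n, …, 1/n) * T ^ N`. -/
def learningProb {ι : Type*} [Fintype ι] [DecidableEq ι] (a : ι → ℝ) (k : ι) (N : ℕ) : ℝ :=
  Matrix.vecMul (fun _ : ι => (1 : ℝ) / (Fintype.card ι : ℝ)) (memorylessMatrix a ^ N) k

/-- The number `N_Δ` of steps that it takes for the learner to hold the correct concept `k` with
probability at least `1 - Δ`.  (If this never happens, the value is `0`.) -/
def learningTime {ι : Type*} [Fintype ι] [DecidableEq ι] (a : ι → ℝ) (k : ι) (Δ : ℝ) : ℕ :=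
  sInf {N : ℕ | 1 - Δ ≤ learningProb a k N}

/-- The overlaps of the correct concept, which is concept number `0`, with the `m + 1` concepts:
the overlap with itself is `1`, those with the `m` other concepts are `a 0, …, a (m - 1)`. -/
def overlapRow (a : ℕ → ℝ) (m : ℕ) : Fin (m + 1) → ℝ :=
  Fin.cons 1 fun i : Fin m => a i

end

/-!
Write `n = m + 1`, `x i = 1 - a i` and `y i = (1 + 1 / m) * x i` for the wrong concepts `i < m`, and
let `F N` be the probability that the learner is wrong after `N` steps. The learner leaves the wrong
concept `i` for each other concept with probability `x i / m`, so off the correct concept the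
transition matrix is a diagonal matrix plus a matrix of rank one, and its resolvent is explicit: up
to a factor, `h i = 1 / (t + y i) + B`, where `B = ∑ i, 1 / (t + y i)`, solves `(t + 1 - T) h = 1`
for every `t ≥ 0`. The expectation `L N` of `h` after `N` steps (`potential`) satisfies
`L 0 = B` and `L (N + 1) = L N - ∑ i, P (concept i) * y i / (t + y i)`, and this gives exponential
bounds for `F` from both sides, without any spectral theory.

* For `t = 0` the loss per step is `F N`, while `B * F N ≤ L N ≤ 2 * B * F N`. Hence
  `F N ≤ exp (-N / (2 W))` with `W = ∑ i, 1 / x i` (`sum_wrongProb_le`), and the learning time is at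
  most `2 * W * |log Δ| + 1`.
* For `t > 0` the loss per step is at most `L N / B`, while `L N ≤ (1 / t + B) * F N`. Hence
  `F N ≥ t B / (1 + t B) * (1 - 1 / B) ^ N` (`le_sum_wrongProb`).
* As a step reaches the correct concept with probability at most `1 / m`, also
  `F N ≥ m / n * (1 - 1 / m) ^ N` (`le_sum_wrongProb_of_le`).

It remains to control the sums over the random overlaps. If `β > 0`, then `1 / x i` has a finite
expectation, `W` is at most linear in `n` by the law of large numbers, and the first and the third
bound show that the learning time is of order `|log Δ| * n`. If `β < 0`, let
`s = n ^ (1 / (1 + β))`, the order of the largest `1 / x i`. With high probability no `x i` is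
below `η / s` for a small `η`, and the sum of the truncated reciprocals has an expectation of
order `s`, so `W` is of order at most `s` (`exists_measure_sum_one_div_gt_le`). For the lower bound,
the number of `i` with `x i ≤ K / s` is a sum of independent indicators whose mean grows with `K`
like `K ^ (1 + β)`; by Chebyshev's inequality it is large with high probability, so that for
`t = 2 * K / s` the product `t B` is large. Then the factor `t B / (1 + t B)` exceeds `Δ₀`, and `B`
is at least a multiple of `s` (`exists_le_learningTime_of_ge`). This needs many concepts; for the
finitely many remaining `n` it is enough that no overlap is close to `0`
(`exists_le_learningTime_of_lt`), and there the condition `1 / n < 1 - Δ₀` says that `F 0 > Δ₀`.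
-/

/-! ### The chain off the correct concept -/

/-- The probability that the learner holds the wrong concept `i` (that is, concept `i + 1` out of
`0, …, m`) after `N` steps. -/
noncomputable def wrongProb (a : ℕ → ℝ) (m N : ℕ) (i : Fin m) : ℝ :=
  learningProb (overlapRow a m) i.succ N

lemma learningProb_succ {ι : Type*} [Fintype ι] [DecidableEq ι] (a : ι → ℝ) (k : ι) (N : ℕ) :
    learningProb a k (N + 1) = ∑ i, learningProb a i N * memorylessMatrix a i k := by
  simp only [learningProb, pow_succ, ← Matrix.vecMul_vecMul]
  rfl

lemma wrongProb_zero (a : ℕ → ℝ) (m : ℕ) (i : Fin m) : wrongProb a m 0 i = 1 / ((m : ℝ) + 1) := by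
  simp [wrongProb, learningProb]

lemma wrongProb_succ (a : ℕ → ℝ) {m : ℕ} (N : ℕ) (j : Fin m) :
    wrongProb a m (N + 1) j = wrongProb a m N j - (1 + 1 / (m : ℝ)) * (1 - a j) * wrongProb a m N j
      + (∑ i : Fin m, (1 - a i) * wrongProb a m N i) / m := by
  have h : ∀ i : Fin m, wrongProb a m N i * memorylessMatrix (overlapRow a m) i.succ j.succ
      = (1 - a i) * wrongProb a m N i / m + (if i = j then
        wrongProb a m N j - (1 + 1 / (m : ℝ)) * (1 - a j) * wrongProb a m N j else 0) := by
    intro i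
    by_cases hij : i = j
    · subst hij
      simp [memorylessMatrix, overlapRow]
      ring
    · simp [memorylessMatrix, overlapRow, hij]
      ring
  rw [wrongProb, learningProb_succ, Fin.sum_univ_succ]
  change _ + ∑ i : Fin m, wrongProb a m N i * _ = _
  simp_rw [h, Finset.sum_add_distrib, ← Finset.sum_div]
  simp [memorylessMatrix, overlapRow, (Fin.succ_ne_zero j).symm]
  ring

lemma learningProb_zero_eq (a : ℕ → ℝ) {m : ℕ} (hm : 1 ≤ m) (N : ℕ) :
    learningProb (overlapRow a m) 0 N = 1 - ∑ i, wrongProb a m N i := by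
  have hm0 : (m : ℝ) ≠ 0 := by positivity
  induction N with
  | zero =>
    simp only [wrongProb_zero]
    simp [learningProb]
    field_simp
    ring
  | succ N ih =>
    rw [learningProb_succ, Fin.sum_univ_succ, ih]
    change _ + ∑ i : Fin m, wrongProb a m N i * _ = _
    simp_rw [wrongProb_succ, Finset.sum_add_distrib, Finset.sum_sub_distrib]
    have h : ∀ i : Fin m, wrongProb a m N i * memorylessMatrix (overlapRow a m) i.succ 0
        = (1 - a i) * wrongProb a m N i / m := by
      intro i
      simp [memorylessMatrix, overlapRow]
      ring
    simp_rw [h, ← Finset.sum_div, mul_assoc, ← Finset.mul_sum]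
    simp [memorylessMatrix, overlapRow]
    field_simp
    ring

lemma wrongProb_nonneg {a : ℕ → ℝ} {m : ℕ} (h0 : ∀ i < m, 0 ≤ a i) (h1 : ∀ i < m, a i ≤ 1)
    (N : ℕ) (i : Fin m) : 0 ≤ wrongProb a m N i := by
  have hm : 1 ≤ m := by have := i.2; omega
  have hm1 : (1 : ℝ) ≤ m := by exact_mod_cast hm
  induction N generalizing i with
  | zero => rw [wrongProb_zero]; positivity
  | succ N ih =>
    rw [wrongProb_succ]
    have hs : (1 - a i) * wrongProb a m N i ≤ ∑ i : Fin m, (1 - a i) * wrongProb a m N i :=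
      Finset.single_le_sum (f := fun i : Fin m => (1 - a i) * wrongProb a m N i)
        (fun j _ => mul_nonneg (by linarith [h1 j j.2]) (ih j)) (Finset.mem_univ i)
    have hs' := div_le_div_of_nonneg_right hs (by linarith : (0 : ℝ) ≤ m)
    have h2 := mul_nonneg (h0 i i.2) (ih i)
    have : (1 + 1 / (m : ℝ)) * (1 - a i) * wrongProb a m N i
        = (1 - a i) * wrongProb a m N i + (1 - a i) * wrongProb a m N i / m := by ring
    linarith

/-- The probability of error decreases by the probability of jumping to the correct concept. -/
lemma sum_wrongProb_succ (a : ℕ → ℝ) {m : ℕ} (hm : 1 ≤ m) (N : ℕ) :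
    ∑ i, wrongProb a m (N + 1) i
      = ∑ i, wrongProb a m N i - (∑ i : Fin m, (1 - a i) * wrongProb a m N i) / m := by
  have hm0 : (m : ℝ) ≠ 0 := by positivity
  simp_rw [wrongProb_succ, Finset.sum_add_distrib, Finset.sum_sub_distrib, mul_assoc,
    ← Finset.mul_sum]
  simp
  field_simp
  ring

/-- A learner holding a wrong concept jumps to the correct one with probability at most `ξ / m`. -/
lemma le_sum_wrongProb_of_le {a : ℕ → ℝ} {m : ℕ} (hm : 1 ≤ m) (h0 : ∀ i < m, 0 ≤ a i)
    (h1 : ∀ i < m, a i ≤ 1) {ξ : ℝ} (hξ : ∀ i < m, 1 - a i ≤ ξ) (hξm : ξ ≤ m) (N : ℕ) :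
    (m : ℝ) / (m + 1) * (1 - ξ / m) ^ N ≤ ∑ i, wrongProb a m N i := by
  have hm0 : (0 : ℝ) < m := by positivity
  induction N with
  | zero => simp [wrongProb_zero, div_eq_mul_inv]
  | succ N ih =>
    have h2 : ∑ i : Fin m, (1 - a i) * wrongProb a m N i ≤ ξ * ∑ i, wrongProb a m N i := by
      rw [Finset.mul_sum]
      exact Finset.sum_le_sum fun i _ =>
        mul_le_mul_of_nonneg_right (hξ i i.2) (wrongProb_nonneg h0 h1 N i)
    have h3 := div_le_div_of_nonneg_right h2 hm0.le
    rw [sum_wrongProb_succ a hm, pow_succ, ← mul_assoc]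
    have h4 : 0 ≤ 1 - ξ / m := by rw [sub_nonneg, div_le_one hm0]; exact hξm
    have h5 := mul_le_mul_of_nonneg_right ih h4
    have : (∑ i, wrongProb a m N i) * (1 - ξ / m)
      = ∑ i, wrongProb a m N i - ξ * (∑ i, wrongProb a m N i) / m := by ring
    linarith

/-! ### A family of potentials -/

/-- The resolvent sum `∑ i, 1 / (t + y i)`, where `y i = (1 + 1 / m) * (1 - a i)`. -/
noncomputable def resolventSum (a : ℕ → ℝ) (m : ℕ) (t : ℝ) : ℝ :=
  ∑ i : Fin m, 1 / (t + (1 + 1 / (m : ℝ)) * (1 - a i))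

/-- The expectation after `N` steps of the function which is `0` at the correct concept and
`1 / (t + y i) + resolventSum a m t` at the wrong concept `i`. Up to a factor, this function is the
solution `h` of `(t + 1 - T) h = 1` off the correct concept; for `t = 0` this solution is the
expected number of steps until the learner reaches the correct concept. -/
noncomputable def potential (a : ℕ → ℝ) (m : ℕ) (t : ℝ) (N : ℕ) : ℝ :=
  ∑ i : Fin m, wrongProb a m N i *
    (1 / (t + (1 + 1 / (m : ℝ)) * (1 - a i)) + resolventSum a m t)

lemma potential_zero (a : ℕ → ℝ) (m : ℕ) (t : ℝ) : potential a m t 0 = resolventSum a m t := by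
  simp only [potential, wrongProb_zero, ← Finset.mul_sum, Finset.sum_add_distrib]
  rw [← resolventSum]
  simp
  field_simp
  ring

lemma potential_succ (a : ℕ → ℝ) {m : ℕ} (hm : 1 ≤ m) (t : ℝ) (N : ℕ) :
    potential a m t (N + 1) = potential a m t N - ∑ i : Fin m, wrongProb a m N i *
      ((1 + 1 / (m : ℝ)) * (1 - a i) / (t + (1 + 1 / (m : ℝ)) * (1 - a i))) := by
  have h : ∀ M, potential a m t M
      = ∑ i : Fin m, wrongProb a m M i * (1 / (t + (1 + 1 / (m : ℝ)) * (1 - a i)))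
        + (∑ i, wrongProb a m M i) * resolventSum a m t := by
    intro M
    simp_rw [potential, mul_add, Finset.sum_add_distrib, Finset.sum_mul]
  rw [h, h, sum_wrongProb_succ a hm]
  set Φ := ∑ i : Fin m, (1 - a i) * wrongProb a m N i with hΦ
  have h2 : ∑ i : Fin m, wrongProb a m (N + 1) i * (1 / (t + (1 + 1 / (m : ℝ)) * (1 - a i)))
      = ∑ i : Fin m, wrongProb a m N i * (1 / (t + (1 + 1 / (m : ℝ)) * (1 - a i)))
        - ∑ i : Fin m, wrongProb a m N i *
          ((1 + 1 / (m : ℝ)) * (1 - a i) / (t + (1 + 1 / (m : ℝ)) * (1 - a i)))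
        + Φ / m * resolventSum a m t := by
    rw [resolventSum, Finset.mul_sum, ← Finset.sum_sub_distrib, ← Finset.sum_add_distrib]
    refine Finset.sum_congr rfl fun i _ => ?_
    rw [wrongProb_succ, ← hΦ]
    ring
  rw [h2]
  ring

/-- The error probability decays at least like `exp (-N / (2 W))`, where
`W = ∑ i, 1 / (1 - a i)`. -/
lemma sum_wrongProb_le {a : ℕ → ℝ} {m : ℕ} (hm : 1 ≤ m) (h0 : ∀ i < m, 0 ≤ a i)
    (h1 : ∀ i < m, a i < 1) (N : ℕ) :
    ∑ i, wrongProb a m N i ≤ Real.exp (-(N / (2 * ∑ i ∈ Finset.range m, 1 / (1 - a i)))) := by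
  have hm0 : (0 : ℝ) < m := by positivity
  set W := ∑ i ∈ Finset.range m, 1 / (1 - a i) with hW
  set B := resolventSum a m 0 with hB
  have hx : ∀ i : Fin m, 0 < 1 - a i := fun i => by linarith [h1 i i.2]
  have hy : ∀ i : Fin m, 0 < (1 + 1 / (m : ℝ)) * (1 - a i) := fun i =>
    mul_pos (by positivity) (hx i)
  have hq := wrongProb_nonneg h0 fun i hi => (h1 i hi).le
  have hyB : ∀ i : Fin m, 1 / (0 + (1 + 1 / (m : ℝ)) * (1 - a i)) ≤ B := fun i =>
    Finset.single_le_sum (f := fun i : Fin m => 1 / (0 + (1 + 1 / (m : ℝ)) * (1 - a i)))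
      (fun j _ => by have := hy j; positivity) (Finset.mem_univ i)
  have hB0 : 0 < B := lt_of_lt_of_le (by have := hy ⟨0, hm⟩; positivity) (hyB ⟨0, hm⟩)
  have hBW : B ≤ W := by
    rw [hW, Finset.sum_range, hB, resolventSum]
    refine Finset.sum_le_sum fun i _ => one_div_le_one_div_of_le (hx i) ?_
    have : 0 ≤ 1 / (m : ℝ) * (1 - a i) := by have := hx i; positivity
    linarith
  have hW0 : 0 < W := hB0.trans_le hBW
  have hL2 : ∀ N, potential a m 0 N ≤ 2 * B * ∑ i, wrongProb a m N i := fun N => by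
    rw [Finset.mul_sum, potential]
    refine Finset.sum_le_sum fun i _ => ?_
    have := mul_le_mul_of_nonneg_left (hyB i) (hq N i)
    rw [mul_add, ← hB]; linarith
  have hL1 : ∀ N, B * ∑ i, wrongProb a m N i ≤ potential a m 0 N := fun N => by
    rw [Finset.mul_sum, potential]
    refine Finset.sum_le_sum fun i _ => ?_
    have : 0 ≤ wrongProb a m N i * (1 / (0 + (1 + 1 / (m : ℝ)) * (1 - a i))) :=
      mul_nonneg (hq N i) (by have := hy i; positivity)
    rw [mul_add, ← hB]; linarith
  have hstep : ∀ N, potential a m 0 (N + 1) ≤ Real.exp (-(1 / (2 * W))) * potential a m 0 N := by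
    intro N
    have h2 : ∑ i : Fin m, wrongProb a m N i *
        ((1 + 1 / (m : ℝ)) * (1 - a i) / (0 + (1 + 1 / (m : ℝ)) * (1 - a i)))
        = ∑ i, wrongProb a m N i := Finset.sum_congr rfl fun i _ => by
      rw [zero_add, div_self (hy i).ne', mul_one]
    have hF : 0 ≤ ∑ i, wrongProb a m N i := Finset.sum_nonneg fun i _ => hq N i
    have hL : 0 ≤ potential a m 0 N := (mul_nonneg hB0.le hF).trans (hL1 N)
    rw [potential_succ a hm, h2]
    have h3 : potential a m 0 N / (2 * W) ≤ ∑ i, wrongProb a m N i := by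
      rw [div_le_iff₀ (by positivity)]
      nlinarith [hL2 N, mul_le_mul_of_nonneg_right hBW hF]
    have h4 : 1 - 1 / (2 * W) ≤ Real.exp (-(1 / (2 * W))) := by
      have := Real.add_one_le_exp (-(1 / (2 * W))); linarith
    have h5 := mul_le_mul_of_nonneg_right h4 hL
    have : (1 - 1 / (2 * W)) * potential a m 0 N
      = potential a m 0 N - potential a m 0 N / (2 * W) := by ring
    linarith
  have hind : potential a m 0 N ≤ Real.exp (-(N / (2 * W))) * B := by
    induction N with
    | zero => simp [potential_zero, hB]
    | succ N ih =>
      refine (hstep N).trans ((mul_le_mul_of_nonneg_left ih (Real.exp_pos _).le).trans_eq ?_)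
      rw [← mul_assoc, ← Real.exp_add]
      congr 2
      push_cast
      ring
  have := (hL1 N).trans hind
  rw [mul_comm] at this
  exact le_of_mul_le_mul_right this hB0

/-- For every `t > 0`, the error probability is at least `t B / (1 + t B) * (1 - 1 / B) ^ N`, where
`B` is the resolvent sum at `t`. -/
lemma le_sum_wrongProb {a : ℕ → ℝ} {m : ℕ} (hm : 1 ≤ m) (h0 : ∀ i < m, 0 ≤ a i)
    (h1 : ∀ i < m, a i < 1) {t : ℝ} (ht : 0 < t) (hB1 : 1 ≤ resolventSum a m t) (N : ℕ) :
    t * resolventSum a m t / (1 + t * resolventSum a m t) * (1 - 1 / resolventSum a m t) ^ N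
      ≤ ∑ i, wrongProb a m N i := by
  set B := resolventSum a m t with hB
  have hB0 : 0 < B := by linarith
  have hy : ∀ i : Fin m, 0 < (1 + 1 / (m : ℝ)) * (1 - a i) := fun i =>
    mul_pos (by positivity) (by linarith [h1 i i.2])
  have hq := wrongProb_nonneg h0 fun i hi => (h1 i hi).le
  have hL2 : potential a m t N ≤ (1 / t + B) * ∑ i, wrongProb a m N i := by
    rw [Finset.mul_sum, potential]
    refine Finset.sum_le_sum fun i _ => ?_
    rw [mul_comm]
    refine mul_le_mul_of_nonneg_right (add_le_add_left ?_ _) (hq N i)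
    exact one_div_le_one_div_of_le ht (by linarith [hy i])
  have hstep : ∀ N, (1 - 1 / B) * potential a m t N ≤ potential a m t (N + 1) := by
    intro N
    rw [potential_succ a hm]
    have h2 : B * ∑ i : Fin m, wrongProb a m N i *
        ((1 + 1 / (m : ℝ)) * (1 - a i) / (t + (1 + 1 / (m : ℝ)) * (1 - a i)))
        ≤ potential a m t N := by
      rw [Finset.mul_sum, potential]
      refine Finset.sum_le_sum fun i _ => ?_
      rw [mul_left_comm, ← hB]
      refine mul_le_mul_of_nonneg_left ?_ (hq N i)
      have h3 : (1 + 1 / (m : ℝ)) * (1 - a i) / (t + (1 + 1 / (m : ℝ)) * (1 - a i)) ≤ 1 := by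
        rw [div_le_one (by linarith [hy i])]; linarith
      have h4 : 0 ≤ 1 / (t + (1 + 1 / (m : ℝ)) * (1 - a i)) := by have := hy i; positivity
      nlinarith
    have h3 := (le_div_iff₀' hB0).mpr h2
    have : (1 - 1 / B) * potential a m t N = potential a m t N - potential a m t N / B := by ring
    linarith
  have hr : 0 ≤ 1 - 1 / B := by rw [sub_nonneg, div_le_one hB0]; exact hB1
  have hind : B * (1 - 1 / B) ^ N ≤ potential a m t N := by
    clear hL2
    induction N with
    | zero => simp [potential_zero, hB]
    | succ N ih =>
      refine le_trans ?_ (hstep N)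
      rw [pow_succ, ← mul_assoc, mul_comm]
      exact mul_le_mul_of_nonneg_left ih hr
  have h5 := hind.trans hL2
  have h6 : t * B / (1 + t * B) * (1 - 1 / B) ^ N = (B * (1 - 1 / B) ^ N) / (1 / t + B) := by
    field_simp
  rw [h6, div_le_iff₀' (by positivity)]
  exact h5

/-! ### Bounds for the learning time of given overlaps -/

lemma exists_learningProb_ge {a : ℕ → ℝ} {m : ℕ} (hm : 1 ≤ m) (h0 : ∀ i < m, 0 ≤ a i)
    (h1 : ∀ i < m, a i < 1) {Δ : ℝ} (hΔ : Δ ∈ Ioo (0 : ℝ) 1) :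
    1 - Δ ≤ learningProb (overlapRow a m) 0
      ⌈2 * (∑ i ∈ Finset.range m, 1 / (1 - a i)) * |Real.log Δ|⌉₊ := by
  have hW : 0 < ∑ i ∈ Finset.range m, 1 / (1 - a i) :=
    Finset.sum_pos (fun i hi => one_div_pos.mpr (by linarith [h1 i (Finset.mem_range.mp hi)]))
      ⟨0, Finset.mem_range.mpr hm⟩
  rw [learningProb_zero_eq a hm, sub_le_sub_iff_left]
  refine (sum_wrongProb_le hm h0 h1 _).trans ?_
  rw [← Real.le_log_iff_exp_le hΔ.1, neg_le, le_div_iff₀ (by positivity)]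
  rw [← abs_of_neg (Real.log_neg hΔ.1 hΔ.2), mul_comm]
  exact Nat.le_ceil _

lemma learningTime_le {a : ℕ → ℝ} {m : ℕ} (hm : 1 ≤ m) (h0 : ∀ i < m, 0 ≤ a i)
    (h1 : ∀ i < m, a i < 1) {Δ : ℝ} (hΔ : Δ ∈ Ioo (0 : ℝ) 1) :
    (learningTime (overlapRow a m) 0 Δ : ℝ)
      ≤ 2 * (∑ i ∈ Finset.range m, 1 / (1 - a i)) * |Real.log Δ| + 1 := by
  have hW : 0 ≤ ∑ i ∈ Finset.range m, 1 / (1 - a i) :=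
    Finset.sum_nonneg fun i hi => one_div_nonneg.mpr (by linarith [h1 i (Finset.mem_range.mp hi)])
  have h : learningTime (overlapRow a m) 0 Δ
      ≤ ⌈2 * (∑ i ∈ Finset.range m, 1 / (1 - a i)) * |Real.log Δ|⌉₊ :=
    Nat.sInf_le (exists_learningProb_ge hm h0 h1 hΔ)
  exact (Nat.cast_le.mpr h).trans (Nat.ceil_lt_add_one (by positivity)).le

/-- A geometric lower bound for the error probability bounds the learning time from below. -/
lemma le_learningTime {a : ℕ → ℝ} {m : ℕ} (hm : 1 ≤ m) (h0 : ∀ i < m, 0 ≤ a i)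
    (h1 : ∀ i < m, a i < 1) {Δ : ℝ} (hΔ : Δ ∈ Ioo (0 : ℝ) 1) {σ r : ℝ} (hσ : 0 < σ) (hr : 0 < r)
    (h : ∀ N, σ * r ^ N ≤ ∑ i, wrongProb a m N i) :
    |Real.log Δ| + Real.log σ ≤ learningTime (overlapRow a m) 0 Δ * -Real.log r := by
  have hmem : 1 - Δ ≤ learningProb (overlapRow a m) 0 (learningTime (overlapRow a m) 0 Δ) :=
    Nat.sInf_mem (s := {N : ℕ | 1 - Δ ≤ learningProb (overlapRow a m) 0 N})
      ⟨_, exists_learningProb_ge hm h0 h1 hΔ⟩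
  rw [learningProb_zero_eq a hm, sub_le_sub_iff_left] at hmem
  have h2 := Real.log_le_log (by positivity) ((h _).trans hmem)
  rw [Real.log_mul hσ.ne' (by positivity), Real.log_pow] at h2
  rw [abs_of_neg (Real.log_neg hΔ.1 hΔ.2)]
  linarith

/-- `le_learningTime` for the ratio `1 - 1 / b`, where `-log (1 - 1 / b) ≤ 1 / (b - 1)`. -/
lemma mul_le_learningTime {a : ℕ → ℝ} {m : ℕ} (hm : 1 ≤ m) (h0 : ∀ i < m, 0 ≤ a i)
    (h1 : ∀ i < m, a i < 1) {Δ : ℝ} (hΔ : Δ ∈ Ioo (0 : ℝ) 1) {σ b : ℝ} (hσ : 0 < σ) (hb : 1 < b)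
    (h : ∀ N, σ * (1 - 1 / b) ^ N ≤ ∑ i, wrongProb a m N i) :
    (b - 1) * (|Real.log Δ| + Real.log σ) ≤ learningTime (overlapRow a m) 0 Δ := by
  have hb0 : 0 < b := by linarith
  have hr : 0 < 1 - 1 / b := by rw [sub_pos, div_lt_one hb0]; exact hb
  have h2 := le_learningTime hm h0 h1 hΔ hσ hr h
  have h3 : -Real.log (1 - 1 / b) ≤ 1 / (b - 1) := by
    have h4 := Real.one_sub_inv_le_log_of_pos hr
    have h5 : 1 - (1 - 1 / b)⁻¹ = -(1 / (b - 1)) := by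
      have : b - 1 ≠ 0 := by linarith
      have h6 : 1 - 1 / b = (b - 1) / b := by field_simp
      rw [h6, inv_div]
      field_simp
      ring
    linarith
  have h4 := h2.trans (mul_le_mul_of_nonneg_left h3 (Nat.cast_nonneg _))
  rw [mul_one_div, le_div_iff₀ (by linarith)] at h4
  linarith

/-! ### The law of a single overlap -/

/-- Near `0` the density of `1 - a i` lies between `c / 2 * x ^ β` and `2 * c * x ^ β`. -/
lemma exists_density_bounds {g : ℝ → ℝ} {c β δ : ℝ} (hc : 0 < c) (hδ : 0 < δ)
    (hf : (fun x : ℝ => g (1 - x) - c * x ^ β) =O[𝓝[>] 0] fun x : ℝ => x ^ (β + δ)) :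
    ∃ r : ℝ, 0 < r ∧ ∀ x, 0 < x → x ≤ r →
      c / 2 * x ^ β ≤ g (1 - x) ∧ g (1 - x) ≤ 2 * c * x ^ β := by
  obtain ⟨C, hC⟩ := hf.bound
  have ht : Tendsto (fun x : ℝ => C * x ^ δ) (𝓝[>] 0) (𝓝 (C * 0)) := by
    refine Tendsto.const_mul C (tendsto_nhdsWithin_of_tendsto_nhds ?_)
    have := (Real.continuousAt_rpow_const 0 δ (Or.inr hδ.le)).tendsto
    rwa [Real.zero_rpow hδ.ne'] at this
  rw [mul_zero] at ht
  have he := hC.and (ht.eventually_le_const (half_pos hc))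
  obtain ⟨u, hu, hu2⟩ := mem_nhdsGT_iff_exists_Ioc_subset.mp he
  refine ⟨u, hu, fun x hx hxu => ?_⟩
  obtain ⟨h1, h2⟩ := hu2 ⟨hx, hxu⟩
  have hxβ : 0 < x ^ β := Real.rpow_pos_of_pos hx β
  rw [Real.norm_eq_abs, Real.norm_eq_abs, abs_of_pos (Real.rpow_pos_of_pos hx _),
    Real.rpow_add hx] at h1
  have h3 := abs_le.mp (h1.trans (show C * (x ^ β * x ^ δ) ≤ c / 2 * x ^ β by
    calc C * (x ^ β * x ^ δ) = C * x ^ δ * x ^ β := by ring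
      _ ≤ _ := mul_le_mul_of_nonneg_right h2 hxβ.le))
  constructor <;> nlinarith

lemma lintegral_Ioc_rpow {β s : ℝ} (hβ : -1 < β) (hs : 0 < s) :
    ∫⁻ x in Ioc 0 s, ENNReal.ofReal (x ^ β) = ENNReal.ofReal (s ^ (1 + β) / (1 + β)) := by
  have hi : IntervalIntegrable (fun x : ℝ => x ^ β) volume 0 s :=
    intervalIntegral.intervalIntegrable_rpow' hβ
  rw [intervalIntegrable_iff_integrableOn_Ioc_of_le hs.le] at hi
  rw [← ofReal_integral_eq_lintegral_ofReal hi, ← intervalIntegral.integral_of_le hs.le,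
    integral_rpow (Or.inl hβ), Real.zero_rpow (by linarith), sub_zero, add_comm β 1]
  filter_upwards [ae_restrict_mem measurableSet_Ioc] with x hx using Real.rpow_nonneg hx.1.le _

lemma lintegral_Ioi_rpow {β τ : ℝ} (hβ : β < 0) (hτ : 0 < τ) :
    ∫⁻ x in Ioi τ, ENNReal.ofReal (x ^ (β - 1)) = ENNReal.ofReal (τ ^ β / -β) := by
  have hb : β - 1 < -1 := by linarith
  rw [← ofReal_integral_eq_lintegral_ofReal (integrableOn_Ioi_rpow_of_lt hb hτ),
    integral_Ioi_rpow_of_lt hb hτ, sub_add_cancel, neg_div, div_neg]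
  filter_upwards [ae_restrict_mem measurableSet_Ioi] with x hx using
    Real.rpow_nonneg (hτ.trans hx).le _

section Law

variable {Ω : Type*} [MeasurableSpace Ω] {μ : Measure Ω} {g : ℝ → ℝ} {Y : Ω → ℝ}

lemma lintegral_one_sub (hg : Measurable g) (hY : Measurable Y)
    (hlaw : μ.map Y = volume.withDensity fun t => ENNReal.ofReal (g t))
    {h : ℝ → ENNReal} (hh : Measurable h) :
    ∫⁻ ω, h (1 - Y ω) ∂μ = ∫⁻ x, ENNReal.ofReal (g (1 - x)) * h x := by
  have hh' : Measurable fun t : ℝ => h (1 - t) := hh.comp (measurable_const.sub measurable_id)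
  rw [← lintegral_map (f := fun t : ℝ => h (1 - t)) hh' hY, hlaw,
    lintegral_withDensity_eq_lintegral_mul _ hg.ennreal_ofReal hh',
    ← lintegral_sub_left_eq_self _ (1 : ℝ)]
  simp

lemma lintegral_density [IsProbabilityMeasure μ] (hg : Measurable g) (hY : Measurable Y)
    (hlaw : μ.map Y = volume.withDensity fun t => ENNReal.ofReal (g t)) :
    ∫⁻ x, ENNReal.ofReal (g (1 - x)) = 1 := by
  have := lintegral_one_sub hg hY hlaw (h := fun _ => 1) measurable_const
  simpa using this.symm

lemma measure_one_sub_le (hg : Measurable g) (hY : Measurable Y)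
    (hlaw : μ.map Y = volume.withDensity fun t => ENNReal.ofReal (g t)) (s : ℝ) :
    μ {ω | 1 - Y ω ≤ s} = ∫⁻ x in Iic s, ENNReal.ofReal (g (1 - x)) := by
  have hm : MeasurableSet {ω | 1 - Y ω ≤ s} :=
    measurableSet_le (measurable_const.sub hY) measurable_const
  have := lintegral_one_sub hg hY hlaw (h := (Iic s).indicator fun _ => 1)
    (measurable_const.indicator measurableSet_Iic)
  have h1 : ∫⁻ ω, (Iic s).indicator (fun _ => (1 : ENNReal)) (1 - Y ω) ∂μ
      = μ {ω | 1 - Y ω ≤ s} := by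
    rw [← lintegral_indicator_one hm]
    rfl
  rw [← h1, this, ← lintegral_indicator measurableSet_Iic]
  congr 1 with x
  by_cases hx : x ∈ Iic s <;> simp [hx]

lemma ae_mem_Ico (hY : Measurable Y) (hg_supp : ∀ t, t ∉ Icc (0 : ℝ) 1 → g t = 0)
    (hlaw : μ.map Y = volume.withDensity fun t => ENNReal.ofReal (g t)) :
    ∀ᵐ ω ∂μ, 0 ≤ Y ω ∧ Y ω < 1 := by
  refine ae_of_ae_map (p := fun t : ℝ => 0 ≤ t ∧ t < 1) hY.aemeasurable ?_
  have h0 : (volume.withDensity fun t => ENNReal.ofReal (g t)) (Icc (0 : ℝ) 1)ᶜ = 0 := by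
    rw [withDensity_apply _ measurableSet_Icc.compl]
    rw [setLIntegral_congr_fun (g := fun _ => 0) measurableSet_Icc.compl]
    · simp
    · intro t ht
      simp [hg_supp t ht]
  have h1 : (volume.withDensity fun t => ENNReal.ofReal (g t)) {(1 : ℝ)} = 0 :=
    withDensity_absolutelyContinuous _ _ (by simp)
  rw [hlaw, ae_iff]
  refine measure_mono_null ?_ (measure_union_null h0 h1)
  intro t ht
  by_contra hcon
  simp only [mem_union, mem_compl_iff, mem_singleton_iff, not_or, not_not, mem_Icc] at hcon
  exact ht ⟨hcon.1.1, lt_of_le_of_ne hcon.1.2 hcon.2⟩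

/-- Overlaps close to `0` are unlikely, since the law of the overlap has no atom at `0`. -/
lemma exists_measure_lt_le [IsProbabilityMeasure μ] (hY : Measurable Y)
    (hg_supp : ∀ t, t ∉ Icc (0 : ℝ) 1 → g t = 0)
    (hlaw : μ.map Y = volume.withDensity fun t => ENNReal.ofReal (g t)) {ε : ℝ} (hε : 0 < ε) :
    ∃ r : ℝ, 0 < r ∧ r < 1 ∧ ∀ Z : Ω → ℝ, Measurable Z → μ.map Z = μ.map Y →
      μ.real {ω | Z ω < r} ≤ ε := by
  have : IsProbabilityMeasure (μ.map Y) := Measure.isProbabilityMeasure_map hY.aemeasurable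
  have h0 : cdf (μ.map Y) 0 = 0 := by
    rw [cdf_eq_real, measureReal_def, hlaw, ENNReal.toReal_eq_zero_iff]
    left
    have h1 : (volume.withDensity fun t => ENNReal.ofReal (g t)) (Iio (0 : ℝ)) = 0 := by
      rw [withDensity_apply _ measurableSet_Iio, setLIntegral_congr_fun (g := fun _ => 0)
        measurableSet_Iio]
      · simp
      · intro t ht
        simp [hg_supp t fun h => not_lt.mpr h.1 ht]
    have h2 : (volume.withDensity fun t => ENNReal.ofReal (g t)) {(0 : ℝ)} = 0 :=
      withDensity_absolutelyContinuous _ _ (by simp)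
    rw [← Iio_union_right]
    exact measure_union_null h1 h2
  have hr := ((cdf (μ.map Y)).right_continuous 0).mono Ioi_subset_Ici_self
  have hr2 : ∀ᶠ x in 𝓝[>] (0 : ℝ), cdf (μ.map Y) x < ε := by
    refine hr.tendsto.eventually_lt_const ?_
    rwa [h0]
  have hr3 : ∀ᶠ x in 𝓝[>] (0 : ℝ), x < 1 := mem_nhdsWithin_of_mem_nhds (Iio_mem_nhds one_pos)
  obtain ⟨r, ⟨hr1, hr4⟩, hr0⟩ := ((hr2.and hr3).and self_mem_nhdsWithin).exists
  refine ⟨r, hr0, hr4, fun Z hZ hZY => le_trans ?_ hr1.le⟩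
  rw [cdf_eq_real, ← hZY, map_measureReal_apply hZ measurableSet_Iic]
  exact measureReal_mono fun ω (hω : Z ω < r) => hω.le

lemma exists_measure_one_sub_le_le [IsProbabilityMeasure μ] (hg : Measurable g)
    (hg_supp : ∀ t, t ∉ Icc (0 : ℝ) 1 → g t = 0)
    (hlaw : μ.map Y = volume.withDensity fun t => ENNReal.ofReal (g t))
    {c β r : ℝ} (hc : 0 < c) (hβ : -1 < β) (hr : 0 < r)
    (hb : ∀ x, 0 < x → x ≤ r → g (1 - x) ≤ 2 * c * x ^ β) :
    ∃ C : ℝ, 0 < C ∧ ∀ Z : Ω → ℝ, Measurable Z → μ.map Z = μ.map Y → ∀ s, 0 < s →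
      μ.real {ω | 1 - Z ω ≤ s} ≤ C * s ^ (1 + β) := by
  have hβ' : 0 < 1 + β := by linarith
  have hr' : 0 < r ^ (1 + β) := Real.rpow_pos_of_pos hr _
  refine ⟨2 * c / (1 + β) + 1 / r ^ (1 + β), by positivity, fun Z hZ hZY s hs => ?_⟩
  rw [hlaw] at hZY
  have hs' : 0 < s ^ (1 + β) := Real.rpow_pos_of_pos hs _
  rw [add_mul]
  rcases le_or_gt s r with hsr | hsr
  · have h1 : μ {ω | 1 - Z ω ≤ s} ≤ ENNReal.ofReal (2 * c / (1 + β) * s ^ (1 + β)) := by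
      rw [measure_one_sub_le hg hZ hZY]
      have h2 : ∫⁻ x in Iic s, ENNReal.ofReal (g (1 - x))
          ≤ ∫⁻ x in Ioc 0 s, ENNReal.ofReal (g (1 - x)) := by
        rw [← Iic_union_Ioc_eq_Iic hs.le]
        refine (lintegral_union_le _ _ _).trans_eq ?_
        rw [setLIntegral_congr Iio_ae_eq_Iic.symm, setLIntegral_congr_fun (g := fun _ => 0)
          measurableSet_Iio]
        · simp
        · intro x hx
          have : x < 0 := hx
          simp [hg_supp (1 - x) fun h => by linarith [h.2]]
      refine h2.trans ((setLIntegral_mono' (g := fun x => ENNReal.ofReal (2 * c) *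
        ENNReal.ofReal (x ^ β)) measurableSet_Ioc fun x hx => ?_).trans_eq ?_)
      · rw [← ENNReal.ofReal_mul (by positivity)]
        exact ENNReal.ofReal_le_ofReal (hb x hx.1 (hx.2.trans hsr))
      · rw [lintegral_const_mul' _ _ ENNReal.ofReal_ne_top, lintegral_Ioc_rpow hβ hs,
          ← ENNReal.ofReal_mul (by positivity)]
        congr 1
        ring
    have := ENNReal.toReal_mono ENNReal.ofReal_ne_top h1
    rw [ENNReal.toReal_ofReal (by positivity)] at this
    exact this.trans (le_add_of_nonneg_right (by positivity))
  · refine measureReal_le_one.trans ?_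
    have : 1 ≤ 1 / r ^ (1 + β) * s ^ (1 + β) := by
      rw [one_div_mul_eq_div, one_le_div hr']
      exact Real.rpow_le_rpow hr.le hsr.le hβ'.le
    have h2 : 0 ≤ 2 * c / (1 + β) * s ^ (1 + β) := by positivity
    linarith

lemma le_measure_one_sub_le [IsProbabilityMeasure μ] (hg : Measurable g) (hY : Measurable Y)
    (hlaw : μ.map Y = volume.withDensity fun t => ENNReal.ofReal (g t))
    {c β r : ℝ} (hc : 0 < c) (hβ : -1 < β)
    (hb : ∀ x, 0 < x → x ≤ r → c / 2 * x ^ β ≤ g (1 - x)) {s : ℝ} (hs : 0 < s) (hsr : s ≤ r) :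
    c / (2 * (1 + β)) * s ^ (1 + β) ≤ μ.real {ω | 1 - Y ω ≤ s} := by
  have hβ' : 0 < 1 + β := by linarith
  rw [measureReal_def, ← ENNReal.ofReal_le_iff_le_toReal (measure_ne_top _ _),
    measure_one_sub_le hg hY hlaw]
  refine le_trans ?_ (lintegral_mono_set (Ioc_subset_Iic_self (a := 0)))
  refine le_trans (Eq.le ?_) (setLIntegral_mono' (f := fun x => ENNReal.ofReal (c / 2) *
    ENNReal.ofReal (x ^ β)) measurableSet_Ioc fun x hx => ?_)
  · rw [lintegral_const_mul' _ _ ENNReal.ofReal_ne_top, lintegral_Ioc_rpow hβ hs,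
      ← ENNReal.ofReal_mul (by positivity)]
    congr 1
    field_simp
  · rw [← ENNReal.ofReal_mul (by positivity)]
    exact ENNReal.ofReal_le_ofReal (hb x hx.1 (hx.2.trans hsr))

/-- Away from `0` the factor `1 / x` is at most `1 / r`, close to `0` the density is at most
`2 * c * x ^ β`. -/
lemma density_mul_inv_le (hg_nonneg : ∀ t, 0 ≤ g t) {c β r : ℝ} (hc : 0 < c) (hr : 0 < r)
    (hb : ∀ x, 0 < x → x ≤ r → g (1 - x) ≤ 2 * c * x ^ β) {x : ℝ} (hx : 0 < x) :
    ENNReal.ofReal (g (1 - x)) * ENNReal.ofReal (1 / x)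
      ≤ (Ioc 0 r).indicator (fun x => ENNReal.ofReal (2 * c) * ENNReal.ofReal (x ^ (β - 1))) x
        + ENNReal.ofReal (1 / r) * ENNReal.ofReal (g (1 - x)) := by
  rcases le_or_gt x r with hxr | hxr
  · rw [indicator_of_mem (show x ∈ Ioc 0 r from ⟨hx, hxr⟩),
      ← ENNReal.ofReal_mul (hg_nonneg _), ← ENNReal.ofReal_mul (by positivity)]
    refine le_add_right (ENNReal.ofReal_le_ofReal ?_)
    rw [Real.rpow_sub_one hx.ne', mul_one_div, ← mul_div_assoc]
    exact div_le_div_of_nonneg_right (hb x hx hxr) hx.le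
  · refine le_add_left ?_
    rw [mul_comm]
    gcongr

/-- For `β > 0`, the reciprocal of `1 - a i` has a finite expectation. -/
lemma integrable_one_div_one_sub [IsProbabilityMeasure μ] (hg : Measurable g) (hY : Measurable Y)
    (hg_nonneg : ∀ t, 0 ≤ g t) (hg_supp : ∀ t, t ∉ Icc (0 : ℝ) 1 → g t = 0)
    (hlaw : μ.map Y = volume.withDensity fun t => ENNReal.ofReal (g t))
    {c β r : ℝ} (hc : 0 < c) (hβ : 0 < β) (hr : 0 < r)
    (hb : ∀ x, 0 < x → x ≤ r → g (1 - x) ≤ 2 * c * x ^ β) :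
    Integrable (fun ω => 1 / (1 - Y ω)) μ := by
  have hm : Measurable fun ω => 1 / (1 - Y ω) := measurable_const.div (measurable_const.sub hY)
  refine ⟨hm.aestronglyMeasurable, ?_⟩
  rw [hasFiniteIntegral_iff_ofReal]
  · rw [lintegral_one_sub hg hY hlaw (h := fun x => ENNReal.ofReal (1 / x)) (by fun_prop)]
    have h1 : ∫⁻ x, ENNReal.ofReal (g (1 - x)) * ENNReal.ofReal (1 / x)
        ≤ ∫⁻ x, ((Ioc 0 r).indicator
          (fun x => ENNReal.ofReal (2 * c) * ENNReal.ofReal (x ^ (β - 1))) x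
          + ENNReal.ofReal (1 / r) * ENNReal.ofReal (g (1 - x))) := by
      refine lintegral_mono fun x => ?_
      rcases le_or_gt x 0 with hx | hx
      · rw [ENNReal.ofReal_of_nonpos (one_div_nonpos.mpr hx), mul_zero]
        exact zero_le
      · exact density_mul_inv_le hg_nonneg hc hr hb hx
    refine h1.trans_lt ?_
    rw [lintegral_add_left (Measurable.indicator (by fun_prop) measurableSet_Ioc),
      lintegral_indicator measurableSet_Ioc, lintegral_const_mul' _ _ ENNReal.ofReal_ne_top,
      lintegral_const_mul' _ _ ENNReal.ofReal_ne_top, lintegral_Ioc_rpow (by linarith) hr,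
      lintegral_density hg hY hlaw, mul_one]
    exact ENNReal.add_lt_top.mpr ⟨ENNReal.mul_lt_top ENNReal.ofReal_lt_top ENNReal.ofReal_lt_top,
      ENNReal.ofReal_lt_top⟩
  · filter_upwards [ae_mem_Ico hY hg_supp hlaw] with ω hω
    exact one_div_nonneg.mpr (by linarith [hω.2])

/-- For `β < 0`, the truncated expectation of the reciprocal of `1 - a i`. -/
lemma exists_lintegral_truncated_le [IsProbabilityMeasure μ] (hg : Measurable g)
    (hY : Measurable Y) (hg_nonneg : ∀ t, 0 ≤ g t)
    (hlaw : μ.map Y = volume.withDensity fun t => ENNReal.ofReal (g t))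
    {c β r : ℝ} (hc : 0 < c) (hβ : β < 0) (hr : 0 < r)
    (hb : ∀ x, 0 < x → x ≤ r → g (1 - x) ≤ 2 * c * x ^ β) :
    ∃ C : ℝ, 0 < C ∧ ∀ Z : Ω → ℝ, Measurable Z → μ.map Z = μ.map Y → ∀ τ, 0 < τ → τ ≤ 1 →
      ∫⁻ ω, (Ioi τ).indicator (fun x => ENNReal.ofReal (1 / x)) (1 - Z ω) ∂μ
        ≤ ENNReal.ofReal (C * τ ^ β) := by
  have hβ' : 0 < -β := by linarith
  refine ⟨2 * c / -β + 1 / r, by positivity, fun Z hZ hZY τ hτ hτ1 => ?_⟩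
  rw [hlaw] at hZY
  have hτβ : 0 < τ ^ β := Real.rpow_pos_of_pos hτ _
  rw [lintegral_one_sub hg hZ hZY (Measurable.indicator (by fun_prop) measurableSet_Ioi)]
  have h1 : ∫⁻ x, ENNReal.ofReal (g (1 - x)) *
      (Ioi τ).indicator (fun x => ENNReal.ofReal (1 / x)) x
      ≤ ∫⁻ x, ((Ioi τ).indicator
        (fun x => ENNReal.ofReal (2 * c) * ENNReal.ofReal (x ^ (β - 1))) x
        + ENNReal.ofReal (1 / r) * ENNReal.ofReal (g (1 - x))) := by
    refine lintegral_mono fun x => ?_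
    by_cases hx : x ∈ Ioi τ
    · rw [indicator_of_mem hx, indicator_of_mem hx]
      refine (density_mul_inv_le hg_nonneg hc hr hb (hτ.trans hx)).trans ?_
      gcongr
      exact indicator_le_self _ _ _
    · simp [hx]
  refine h1.trans ?_
  rw [lintegral_add_left (Measurable.indicator (by fun_prop) measurableSet_Ioi),
    lintegral_indicator measurableSet_Ioi, lintegral_const_mul' _ _ ENNReal.ofReal_ne_top,
    lintegral_const_mul' _ _ ENNReal.ofReal_ne_top, lintegral_Ioi_rpow hβ hτ,
    lintegral_density hg hY hlaw, mul_one, ← ENNReal.ofReal_mul (by positivity),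
    ← ENNReal.ofReal_add (by positivity) (by positivity)]
  refine ENNReal.ofReal_le_ofReal ?_
  have h2 : 1 ≤ τ ^ β := Real.one_le_rpow_of_pos_of_le_one_of_nonpos hτ hτ1 hβ.le
  have h3 : 1 / r * 1 ≤ 1 / r * τ ^ β := mul_le_mul_of_nonneg_left h2 (by positivity)
  have h4 : 2 * c * (τ ^ β / -β) = 2 * c / -β * τ ^ β := by ring
  rw [add_mul, h4]
  linarith

end Law

/-! ### The sum of the reciprocals of `1 - a i` -/

section Sums

variable {Ω : Type*} [MeasurableSpace Ω] {μ : Measure Ω} [IsProbabilityMeasure μ] {g : ℝ → ℝ}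
  {a : ℕ → Ω → ℝ}

/-- For `β > 0` the sum is at most linear in `m`, by the law of large numbers. -/
lemma tendsto_measure_sum_one_div_gt (ha_meas : ∀ i, Measurable (a i)) (ha_indep : iIndepFun a μ)
    (hmap : ∀ i, μ.map (a i) = μ.map (a 0)) (hint : Integrable (fun ω => 1 / (1 - a 0 ω)) μ) :
    Tendsto (fun m : ℕ => μ.real {ω | ((∫ ω, 1 / (1 - a 0 ω) ∂μ) + 1) * m
      < ∑ i ∈ Finset.range m, 1 / (1 - a i ω)}) atTop (𝓝 0) := by
  have hφ : Measurable fun t : ℝ => 1 / (1 - t) := by fun_prop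
  have hident : ∀ i, IdentDistrib (fun ω => 1 / (1 - a i ω)) (fun ω => 1 / (1 - a 0 ω)) μ μ :=
    fun i => IdentDistrib.comp (u := fun t : ℝ => 1 / (1 - t))
      ⟨(ha_meas i).aemeasurable, (ha_meas 0).aemeasurable, hmap i⟩ hφ
  have hslln := strong_law_ae_real (fun i ω => 1 / (1 - a i ω)) hint
    (fun i j hij => (ha_indep.indepFun hij).comp hφ hφ) hident
  set E := ∫ ω, 1 / (1 - a 0 ω) ∂μ
  have hmeas : ∀ m : ℕ, AEStronglyMeasurable
      (fun ω => (∑ i ∈ Finset.range m, 1 / (1 - a i ω)) / (m : ℝ)) μ := fun m =>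
    (Measurable.div_const (Finset.measurable_sum _ fun i _ => hφ.comp (ha_meas i))
      _).aestronglyMeasurable
  have hT := tendstoInMeasure_of_tendsto_ae hmeas hslln
  rw [tendstoInMeasure_iff_measureReal_dist] at hT
  refine squeeze_zero' (Eventually.of_forall fun m => measureReal_nonneg) ?_ (hT 1 one_pos)
  filter_upwards [eventually_ge_atTop 1] with m hm
  have hm0 : (0 : ℝ) < m := by positivity
  refine measureReal_mono fun ω hω => ?_
  rw [mem_ofPred_eq, ← lt_div_iff₀ hm0] at hω
  rw [mem_ofPred_eq, Real.dist_eq]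
  exact le_trans (by linarith) (le_abs_self _)

/-- For `β < 0` the sum is of order at most `(m + 1) ^ (1 / (1 + β))`: with high probability all
terms are below a large multiple of this number, and the sum of the terms truncated there has an
expectation of this order. -/
lemma exists_measure_sum_one_div_gt_le (hg : Measurable g) (hg_nonneg : ∀ t, 0 ≤ g t)
    (hg_supp : ∀ t, t ∉ Icc (0 : ℝ) 1 → g t = 0) (ha_meas : ∀ i, Measurable (a i))
    (ha_law : ∀ i, μ.map (a i) = volume.withDensity fun t => ENNReal.ofReal (g t))
    {c β r : ℝ} (hc : 0 < c) (hβ : -1 < β) (hβ0 : β < 0) (hr : 0 < r)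
    (hb : ∀ x, 0 < x → x ≤ r → g (1 - x) ≤ 2 * c * x ^ β) {ε : ℝ} (hε : 0 < ε) :
    ∃ A : ℝ, 0 < A ∧ ∀ m : ℕ, μ.real {ω | A * ((m + 1 : ℕ) : ℝ) ^ (1 / (1 + β))
      < ∑ i ∈ Finset.range m, 1 / (1 - a i ω)} ≤ ε := by
  have hβ' : 0 < 1 + β := by linarith
  obtain ⟨C, hC, hCle⟩ := exists_measure_one_sub_le_le hg hg_supp (ha_law 0) hc hβ hr hb
  obtain ⟨D, hD, hDle⟩ := exists_lintegral_truncated_le hg (ha_meas 0) hg_nonneg (ha_law 0)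
    hc hβ0 hr hb
  have hmap : ∀ i, μ.map (a i) = μ.map (a 0) := fun i => by rw [ha_law, ha_law]
  -- the truncation level `η / s`, where `s = (m + 1) ^ (1 / (1 + β))`
  obtain ⟨η, hη0, hη1, hηε⟩ : ∃ η : ℝ, 0 < η ∧ η ≤ 1 ∧ C * η ^ (1 + β) ≤ ε / 2 := by
    have ht : Tendsto (fun x : ℝ => C * x ^ (1 + β)) (𝓝[>] 0) (𝓝 (C * 0)) := by
      refine Tendsto.const_mul C (tendsto_nhdsWithin_of_tendsto_nhds ?_)
      have := (Real.continuousAt_rpow_const 0 (1 + β) (Or.inr hβ'.le)).tendsto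
      rwa [Real.zero_rpow hβ'.ne'] at this
    rw [mul_zero] at ht
    have hr3 : ∀ᶠ x in 𝓝[>] (0 : ℝ), x < 1 := mem_nhdsWithin_of_mem_nhds (Iio_mem_nhds one_pos)
    obtain ⟨η, ⟨h1, h2⟩, h3⟩ :=
      (((ht.eventually_le_const (half_pos hε)).and hr3).and self_mem_nhdsWithin).exists
    exact ⟨η, h3, h2.le, h1⟩
  have hηβ : 0 < η ^ β := Real.rpow_pos_of_pos hη0 _
  refine ⟨2 * D * η ^ β / ε, by positivity, fun m => ?_⟩
  set s : ℝ := ((m + 1 : ℕ) : ℝ) ^ (1 / (1 + β)) with hs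
  have hm1 : (1 : ℝ) ≤ ((m + 1 : ℕ) : ℝ) := by exact_mod_cast Nat.le_add_left 1 m
  have hs1 : 1 ≤ s := Real.one_le_rpow hm1 (by positivity)
  have hs0 : 0 < s := by linarith
  have hspow : s ^ (1 + β) = m + 1 := by
    rw [hs, ← Real.rpow_mul (by linarith), one_div_mul_cancel hβ'.ne', Real.rpow_one]
    push_cast
    ring
  set τ := η / s with hτ
  have hτ0 : 0 < τ := by positivity
  have hτ1 : τ ≤ 1 := by rw [hτ, div_le_one hs0]; linarith
  set A := 2 * D * η ^ β / ε with hA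
  have hA0 : 0 < A := by positivity
  set V : Ω → ENNReal := fun ω => ∑ i ∈ Finset.range m,
    (Ioi τ).indicator (fun x => ENNReal.ofReal (1 / x)) (1 - a i ω) with hV
  have hind : Measurable ((Ioi τ).indicator fun x : ℝ => ENNReal.ofReal (1 / x)) :=
    Measurable.indicator (by fun_prop) measurableSet_Ioi
  have hVi : ∀ i, Measurable fun ω =>
      (Ioi τ).indicator (fun x => ENNReal.ofReal (1 / x)) (1 - a i ω) := fun i =>
    hind.comp (measurable_const.sub (ha_meas i))
  have hVm : Measurable V := Finset.measurable_sum _ fun i _ => hVi i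
  have hsub : {ω | A * s < ∑ i ∈ Finset.range m, 1 / (1 - a i ω)}
      ⊆ (⋃ i ∈ Finset.range m, {ω | 1 - a i ω ≤ τ}) ∪ {ω | ENNReal.ofReal (A * s) ≤ V ω} := by
    intro ω hω
    by_cases h : ∃ i ∈ Finset.range m, 1 - a i ω ≤ τ
    · left
      obtain ⟨i, hi, hi2⟩ := h
      exact mem_biUnion (Finset.mem_coe.mpr hi) hi2
    · right
      push Not at h
      have : V ω = ENNReal.ofReal (∑ i ∈ Finset.range m, 1 / (1 - a i ω)) := by
        rw [ENNReal.ofReal_sum_of_nonneg]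
        · exact Finset.sum_congr rfl fun i hi => indicator_of_mem (show _ ∈ Ioi τ from h i hi) _
        · intro i hi
          exact one_div_nonneg.mpr (hτ0.trans (h i hi)).le
      rw [mem_ofPred_eq, this]
      exact ENNReal.ofReal_le_ofReal (le_of_lt hω)
  have h1 : μ.real (⋃ i ∈ Finset.range m, {ω | 1 - a i ω ≤ τ}) ≤ ε / 2 := by
    refine (measureReal_biUnion_finset_le _ _).trans ?_
    refine (Finset.sum_le_sum fun i _ => hCle (a i) (ha_meas i) (hmap i) τ hτ0).trans ?_
    rw [Finset.sum_const, Finset.card_range, nsmul_eq_mul, hτ, Real.div_rpow hη0.le hs0.le, hspow]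
    refine le_trans ?_ hηε
    have : (m : ℝ) * (C * (η ^ (1 + β) / (m + 1))) = C * η ^ (1 + β) * (m / (m + 1)) := by ring
    rw [this]
    refine mul_le_of_le_one_right (by positivity) ?_
    rw [div_le_one (by positivity)]
    linarith
  have h2 : μ.real {ω | ENNReal.ofReal (A * s) ≤ V ω} ≤ ε / 2 := by
    have h3 := mul_meas_ge_le_lintegral (μ := μ) hVm (ENNReal.ofReal (A * s))
    have h4 : ∫⁻ ω, V ω ∂μ ≤ ENNReal.ofReal (m * (D * τ ^ β)) := by
      rw [hV, lintegral_finsetSum _ fun i _ => hVi i]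
      refine (Finset.sum_le_sum fun i _ =>
        hDle (a i) (ha_meas i) (hmap i) τ hτ0 hτ1).trans_eq ?_
      rw [Finset.sum_const, Finset.card_range, nsmul_eq_mul,
        ENNReal.ofReal_mul (Nat.cast_nonneg m), ENNReal.ofReal_natCast]
    have h5 := ENNReal.toReal_mono ENNReal.ofReal_ne_top (h3.trans h4)
    rw [ENNReal.toReal_mul, ENNReal.toReal_ofReal (by positivity),
      ENNReal.toReal_ofReal (by positivity), ← measureReal_def] at h5
    have h6 : τ ^ β * (m + 1) = η ^ β * s := by
      rw [hτ, Real.div_rpow hη0.le hs0.le, ← hspow, Real.rpow_add hs0, Real.rpow_one]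
      have : s ^ β ≠ 0 := (Real.rpow_pos_of_pos hs0 _).ne'
      field_simp
    have h7 : (m : ℝ) * (D * τ ^ β) ≤ A * s * (ε / 2) := by
      have : A * s * (ε / 2) = D * (η ^ β * s) := by rw [hA]; field_simp
      rw [this, ← h6]
      have : 0 ≤ D * τ ^ β := by positivity
      nlinarith
    exact le_of_mul_le_mul_left (h5.trans h7) (by positivity)
  calc _ ≤ _ := measureReal_mono hsub
    _ ≤ _ := measureReal_union_le _ _
    _ ≤ ε := by linarith

end Sums

/-! ### The number of overlaps close to `1` -/

/-- If the expected number of indices `i < m` with `1 - a i ≤ s` is at least `M ≥ 2 z`, then there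
are fewer than `z` of them with probability at most `4 / M` (Chebyshev's inequality). -/
lemma measure_card_lt_le {Ω : Type*} [MeasurableSpace Ω] {μ : Measure Ω} [IsProbabilityMeasure μ]
    {a : ℕ → Ω → ℝ} (ha_meas : ∀ i, Measurable (a i)) (ha_indep : iIndepFun a μ) {s p z : ℝ}
    {m : ℕ} (hp : ∀ i, p ≤ μ.real {ω | 1 - a i ω ≤ s}) (hmp : 0 < m * p) (hz : 2 * z ≤ m * p) :
    μ.real {ω | (((Finset.range m).filter fun i => 1 - a i ω ≤ s).card : ℝ) < z}
      ≤ 4 / (m * p) := by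
  set φ : ℝ → ℝ := (Ici (1 - s)).indicator 1 with hφ
  have hφm : Measurable φ := measurable_one.indicator measurableSet_Ici
  set X : ℕ → Ω → ℝ := fun i ω => φ (a i ω) with hX
  have hXm : ∀ i, Measurable (X i) := fun i => hφm.comp (ha_meas i)
  have hXeq : ∀ i, X i = {ω | 1 - a i ω ≤ s}.indicator 1 := by
    intro i
    ext ω
    by_cases h : 1 - a i ω ≤ s
    · rw [indicator_of_mem (show ω ∈ {ω | 1 - a i ω ≤ s} from h)]
      exact indicator_of_mem (show a i ω ∈ Ici (1 - s) from sub_le_comm.mp h) _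
    · rw [indicator_of_notMem (show ω ∉ {ω | 1 - a i ω ≤ s} from h)]
      exact indicator_of_notMem (show a i ω ∉ Ici (1 - s) from fun h' => h (sub_le_comm.mp h')) _
  have hSm : ∀ i, MeasurableSet {ω | 1 - a i ω ≤ s} := fun i =>
    measurableSet_le (measurable_const.sub (ha_meas i)) measurable_const
  have hXL : ∀ i, MemLp (X i) 2 μ := fun i => by
    rw [hXeq]
    exact memLp_indicator_const 2 (hSm i) (1 : ℝ) (Or.inr (measure_ne_top _ _))
  have hEX : ∀ i, μ[X i] = μ.real {ω | 1 - a i ω ≤ s} := fun i => by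
    rw [hXeq, integral_indicator_one (hSm i)]
  have hvar : ∀ i, variance (X i) μ ≤ μ.real {ω | 1 - a i ω ≤ s} := fun i => by
    refine (variance_le_expectation_sq (hXm i).aestronglyMeasurable).trans_eq ?_
    rw [← hEX]
    congr 1
    ext ω
    rw [hXeq, Pi.pow_apply]
    by_cases h : ω ∈ {ω | 1 - a i ω ≤ s}
    · rw [indicator_of_mem h, Pi.one_apply, one_pow]
    · rw [indicator_of_notMem h, zero_pow two_ne_zero]
  have hindep : Pairwise fun i j => IndepFun (X i) (X j) μ := fun i j hij =>
    (ha_indep.indepFun hij).comp hφm hφm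
  set S : Ω → ℝ := ∑ i ∈ Finset.range m, X i with hS
  have hSL : MemLp S 2 μ := memLp_finsetSum' _ fun i _ => hXL i
  set M := ∑ i ∈ Finset.range m, μ.real {ω | 1 - a i ω ≤ s} with hM
  have hES : μ[S] = M := by
    simp only [hS, Finset.sum_apply]
    rw [integral_finsetSum _ fun i _ => (hXL i).integrable (by norm_num)]
    exact Finset.sum_congr rfl fun i _ => hEX i
  have hVS : variance S μ ≤ M := by
    rw [hS, IndepFun.variance_sum (fun i _ => hXL i) fun i _ j _ hij => hindep hij]
    exact Finset.sum_le_sum fun i _ => hvar i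
  have hMp : m * p ≤ M := by
    have := Finset.sum_le_sum fun i (_ : i ∈ Finset.range m) => hp i
    rwa [Finset.sum_const, Finset.card_range, nsmul_eq_mul] at this
  have hM0 : 0 < M := hmp.trans_le hMp
  have hcheb := meas_ge_le_variance_div_sq hSL (half_pos hM0)
  have hcard : ∀ ω, (((Finset.range m).filter fun i => 1 - a i ω ≤ s).card : ℝ) = S ω := by
    intro ω
    rw [hS, Finset.sum_apply, Finset.card_filter]
    push_cast
    refine Finset.sum_congr rfl fun i _ => ?_
    rw [hXeq]
    simp [indicator]
  have hsub : {ω | (((Finset.range m).filter fun i => 1 - a i ω ≤ s).card : ℝ) < z}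
      ⊆ {ω | M / 2 ≤ |S ω - μ[S]|} := by
    intro ω hω
    rw [mem_ofPred_eq, hcard] at hω
    rw [mem_ofPred_eq, hES, abs_sub_comm]
    exact le_trans (by linarith) (le_abs_self _)
  have h1 := ENNReal.toReal_mono ENNReal.ofReal_ne_top ((measure_mono hsub).trans hcheb)
  rw [← measureReal_def, ENNReal.toReal_ofReal (div_nonneg (variance_nonneg _ _) (sq_nonneg _))]
    at h1
  refine h1.trans ?_
  calc variance S μ / (M / 2) ^ 2 ≤ M / (M / 2) ^ 2 := by gcongr
    _ = 4 / M := by field_simp; norm_num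
    _ ≤ 4 / (m * p) := by gcongr

/-- Each `i` with `1 - a i ≤ t / 2` contributes at least `1 / (2 t)` to the resolvent sum at `t`. -/
lemma card_div_le_resolventSum {a : ℕ → ℝ} {m : ℕ} (hm : 1 ≤ m) (h1 : ∀ i < m, a i < 1) {t : ℝ}
    (ht : 0 < t) :
    (((Finset.range m).filter fun i => 1 - a i ≤ t / 2).card : ℝ) / (2 * t)
      ≤ resolventSum a m t := by
  have hm1 : (1 : ℝ) ≤ m := by exact_mod_cast hm
  have hinv : 1 / (m : ℝ) ≤ 1 := by rw [div_le_one (by linarith)]; exact hm1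
  have hinv0 : 0 ≤ 1 / (m : ℝ) := by positivity
  rw [resolventSum, ← Finset.sum_range fun i => 1 / (t + (1 + 1 / (m : ℝ)) * (1 - a i)),
    Finset.card_filter]
  push_cast
  rw [Finset.sum_div]
  refine Finset.sum_le_sum fun i hi => ?_
  have hx : 0 < 1 - a i := by linarith [h1 i (Finset.mem_range.mp hi)]
  split_ifs with h
  · refine one_div_le_one_div_of_le (by positivity) ?_
    nlinarith
  · rw [zero_div]
    positivity

/-! ### Bounds for the learning time of random overlaps -/

lemma dist_one_measureReal_le {Ω : Type*} [MeasurableSpace Ω] {μ : Measure Ω}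
    [IsProbabilityMeasure μ] {S B : Set Ω} (h : ∀ᵐ ω ∂μ, ω ∉ B → ω ∈ S) :
    dist (1 : ℝ) (μ.real S) ≤ μ.real B := by
  have h1 : μ univ ≤ μ (S ∪ B) := by
    refine measure_mono_ae ?_
    filter_upwards [h] with ω hω _
    by_cases hB : ω ∈ B
    · exact Or.inr hB
    · exact Or.inl (hω hB)
  have h2 := ENNReal.toReal_mono (measure_ne_top _ _) h1
  rw [← measureReal_def, ← measureReal_def, probReal_univ] at h2
  have h3 := measureReal_union_le (μ := μ) S B
  rw [Real.dist_eq, abs_of_nonneg (sub_nonneg.mpr measureReal_le_one)]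
  linarith

lemma abs_log_le_abs_log {Δ Δ₀ : ℝ} (hΔ₀ : Δ₀ < 1) (hΔ : Δ ∈ Ioc 0 Δ₀) :
    |Real.log Δ₀| ≤ |Real.log Δ| := by
  rw [abs_of_neg (Real.log_neg (hΔ.1.trans_le hΔ.2) hΔ₀),
    abs_of_neg (Real.log_neg hΔ.1 (hΔ.2.trans_lt hΔ₀)), neg_le_neg_iff]
  exact Real.log_le_log hΔ.1 hΔ.2

/-- If the error probability starts at some `σ > Δ₀`, the factor `log (σ / Δ)` is at least a
constant multiple of `|log Δ|`, uniformly in `Δ ≤ Δ₀`. -/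
lemma exists_mul_abs_log_le {Δ₀ σ : ℝ} (hΔ₀ : Δ₀ ∈ Ioo (0 : ℝ) 1) (hσ : Δ₀ < σ) (hσ1 : σ ≤ 1) :
    ∃ κ : ℝ, 0 < κ ∧ ∀ Δ ∈ Ioc 0 Δ₀, κ * |Real.log Δ| ≤ |Real.log Δ| + Real.log σ := by
  have hl : 0 < |Real.log Δ₀| := abs_pos.mpr (Real.log_neg hΔ₀.1 hΔ₀.2).ne
  refine ⟨1 + Real.log σ / |Real.log Δ₀|, ?_, fun Δ hΔ => ?_⟩
  · have h1 := Real.log_lt_log hΔ₀.1 hσ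
    rw [← neg_lt_iff_pos_add', lt_div_iff₀ hl, abs_of_neg (Real.log_neg hΔ₀.1 hΔ₀.2)]
    linarith
  · have h1 := abs_log_le_abs_log hΔ₀.2 hΔ
    have h2 : Real.log σ ≤ 0 := Real.log_nonpos (hΔ₀.1.trans hσ).le hσ1
    have h3 : Real.log σ / |Real.log Δ₀| * |Real.log Δ|
        ≤ Real.log σ / |Real.log Δ₀| * |Real.log Δ₀| :=
      mul_le_mul_of_nonpos_left h1 (div_nonpos_of_nonpos_of_nonneg h2 hl.le)
    rw [div_mul_cancel₀ _ hl.ne'] at h3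
    linarith

/-- For given overlaps with `∑ i, 1 / (1 - a i) ≤ w * m`, the learning time lies between multiples
of `|log Δ| * (m + 1)`, once `m` is large in terms of `Δ₀`. -/
lemma learningTime_div_mem_Ioo {a : ℕ → ℝ} {m : ℕ} (h0 : ∀ i < m, 0 ≤ a i)
    (h1 : ∀ i < m, a i < 1) {Δ Δ₀ w : ℝ} (hΔ₀ : Δ₀ ∈ Ioo (0 : ℝ) 1) (hΔ : Δ ∈ Ioc 0 Δ₀)
    (hm : 3 ≤ m) (hmΔ : 4 / |Real.log Δ₀| < m) (hw : 0 ≤ w)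
    (hW : ∑ i ∈ Finset.range m, 1 / (1 - a i) ≤ w * m) :
    (learningTime (overlapRow a m) 0 Δ : ℝ) / (|Real.log Δ| * ((m + 1 : ℕ) : ℝ))
      ∈ Ioo (1 / 4) (2 * w + 1) := by
  have hl : 0 < |Real.log Δ₀| := abs_pos.mpr (Real.log_neg hΔ₀.1 hΔ₀.2).ne
  have hlΔ := abs_log_le_abs_log hΔ₀.2 hΔ
  have hΔ1 : Δ ∈ Ioo (0 : ℝ) 1 := ⟨hΔ.1, hΔ.2.trans_lt hΔ₀.2⟩
  set l := |Real.log Δ| with hldef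
  have hl0 : 0 < l := hl.trans_le hlΔ
  have hm1 : 1 ≤ m := by omega
  have hm3 : (3 : ℝ) ≤ m := by exact_mod_cast hm
  have hm0 : (0 : ℝ) < m := by linarith
  rw [div_lt_iff₀ hl] at hmΔ
  have hml : (m : ℝ) * |Real.log Δ₀| ≤ m * l := by gcongr
  have hn : (0 : ℝ) < l * ((m + 1 : ℕ) : ℝ) := by positivity
  constructor
  · rw [lt_div_iff₀ hn]
    have h := mul_le_learningTime hm1 h0 h1 hΔ1 (σ := (m : ℝ) / (m + 1)) (b := m) (by positivity)
      (by linarith) fun N => le_sum_wrongProb_of_le hm1 h0 (fun i hi => (h1 i hi).le) (ξ := 1)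
        (fun i hi => by linarith [h0 i hi]) (by linarith) N
    refine lt_of_lt_of_le ?_ h
    have hσ : -(l / 4) ≤ Real.log ((m : ℝ) / (m + 1)) := by
      have h2 := Real.one_sub_inv_le_log_of_pos (show (0 : ℝ) < (m : ℝ) / (m + 1) by positivity)
      have h3 : 1 - ((m : ℝ) / (m + 1))⁻¹ = -(1 / m) := by field_simp; ring
      have h4 : 1 / (m : ℝ) ≤ l / 4 := by
        rw [div_le_div_iff₀ hm0 (by norm_num)]; linarith
      linarith
    have h5 : ((m : ℝ) - 1) * (l - l / 4) ≤ (m - 1) * (l + Real.log ((m : ℝ) / (m + 1))) :=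
      mul_le_mul_of_nonneg_left (by linarith) (by linarith)
    refine lt_of_lt_of_le ?_ h5
    push_cast
    nlinarith
  · rw [div_lt_iff₀ hn]
    refine (learningTime_le hm1 h0 h1 hΔ1).trans_lt ?_
    rw [← hldef]
    have h2 : 2 * (∑ i ∈ Finset.range m, 1 / (1 - a i)) * l ≤ 2 * (w * m) * l := by gcongr
    push_cast
    have h3 : 0 ≤ w * l := by positivity
    nlinarith

section Random

variable {Ω : Type*} [MeasurableSpace Ω] {μ : Measure Ω} [IsProbabilityMeasure μ] {g : ℝ → ℝ}
  {a : ℕ → Ω → ℝ}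

/-- Lower bound for a bounded number of concepts. -/
lemma exists_le_learningTime_of_lt (hg_supp : ∀ t, t ∉ Icc (0 : ℝ) 1 → g t = 0)
    (ha_meas : ∀ i, Measurable (a i))
    (ha_law : ∀ i, μ.map (a i) = volume.withDensity fun t => ENNReal.ofReal (g t))
    {Δ₀ θ α ε : ℝ} (hΔ₀ : Δ₀ ∈ Ioo (0 : ℝ) 1) (hθ : Δ₀ < θ) (hθ1 : θ ≤ 1) (hα : 0 ≤ α)
    (hε : 0 < ε) (M : ℕ) :
    ∃ κ : ℝ, 0 < κ ∧ ∀ m : ℕ, 1 ≤ m → m < M → θ ≤ (m : ℝ) / (m + 1) → ∃ B : Set Ω,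
      μ.real B ≤ ε ∧ ∀ᵐ ω ∂μ, ω ∉ B → ∀ Δ ∈ Ioc 0 Δ₀,
        κ * (|Real.log Δ| * ((m + 1 : ℕ) : ℝ) ^ α)
          ≤ learningTime (overlapRow (fun i => a i ω) m) 0 Δ := by
  obtain ⟨κ, hκ, hκle⟩ := exists_mul_abs_log_le hΔ₀ hθ hθ1
  obtain ⟨r, hr0, hr1, hr⟩ := exists_measure_lt_le (ha_meas 0) hg_supp (ha_law 0)
    (show 0 < ε / (M + 1) by positivity)
  have hlog : 0 < -Real.log r := neg_pos.mpr (Real.log_neg hr0 hr1)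
  have hs : (0 : ℝ) < ((M + 1 : ℕ) : ℝ) ^ α := Real.rpow_pos_of_pos (by positivity) _
  refine ⟨κ / (-Real.log r * ((M + 1 : ℕ) : ℝ) ^ α), by positivity, fun m hm hmM hmθ =>
    ⟨⋃ i ∈ Finset.range M, {ω | a i ω < r}, ?_, ?_⟩⟩
  · refine (measureReal_biUnion_finset_le _ _).trans ((Finset.sum_le_sum fun i _ =>
      hr (a i) (ha_meas i) (by rw [ha_law, ha_law])).trans ?_)
    rw [Finset.sum_const, Finset.card_range, nsmul_eq_mul, mul_div_assoc', div_le_iff₀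
      (by positivity)]
    nlinarith
  · filter_upwards [ae_all_iff.mpr fun i => ae_mem_Ico (ha_meas i) hg_supp (ha_law i)] with ω hω hB
      Δ hΔ
    have hle : ∀ i < m, r ≤ a i ω := by
      intro i hi
      by_contra h
      exact hB (mem_biUnion (Finset.mem_coe.mpr (Finset.mem_range.mpr (hi.trans hmM)))
        (not_le.mp h))
    have hm1 : (1 : ℝ) ≤ m := by exact_mod_cast hm
    have h0 : ∀ i < m, 0 ≤ a i ω := fun i _ => (hω i).1
    have h1 : ∀ i < m, a i ω < 1 := fun i _ => (hω i).2
    have h := le_learningTime hm h0 h1 (Δ := Δ) ⟨hΔ.1, hΔ.2.trans_lt hΔ₀.2⟩ (hΔ₀.1.trans hθ) hr0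
      fun N => by
        refine le_trans ?_ (le_sum_wrongProb_of_le hm h0 (fun i hi => (h1 i hi).le) (ξ := 1 - r)
          (fun i hi => by linarith [hle i hi]) (by linarith) N)
        have h2 : (1 - r) / m ≤ 1 - r := div_le_self (by linarith) hm1
        have h3 : r ≤ 1 - (1 - r) / m := by linarith
        gcongr
    have h4 := (hκle Δ hΔ).trans h
    have h5 : ((m + 1 : ℕ) : ℝ) ^ α ≤ ((M + 1 : ℕ) : ℝ) ^ α := by gcongr
    rw [div_mul_eq_mul_div, div_le_iff₀ (by positivity), ← mul_assoc, ← mul_assoc]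
    exact mul_le_mul h4 h5 (by positivity) (mul_nonneg (Nat.cast_nonneg _) hlog.le)

/-- Lower bound for a large number of concepts: for large `K`, many overlaps are likely to be within
`K / (m + 1) ^ (1 / (1 + β))` of `1`. -/
lemma exists_le_learningTime_of_ge (hg : Measurable g)
    (hg_supp : ∀ t, t ∉ Icc (0 : ℝ) 1 → g t = 0) (ha_meas : ∀ i, Measurable (a i))
    (ha_indep : iIndepFun a μ)
    (ha_law : ∀ i, μ.map (a i) = volume.withDensity fun t => ENNReal.ofReal (g t))
    {c β r : ℝ} (hc : 0 < c) (hβ : -1 < β) (hr : 0 < r)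
    (hb : ∀ x, 0 < x → x ≤ r → c / 2 * x ^ β ≤ g (1 - x))
    {Δ₀ ε : ℝ} (hΔ₀ : Δ₀ ∈ Ioo (0 : ℝ) 1) (hε : 0 < ε) :
    ∃ κ : ℝ, 0 < κ ∧ ∃ M : ℕ, ∀ m : ℕ, M ≤ m → ∃ B : Set Ω,
      μ.real B ≤ ε ∧ ∀ᵐ ω ∂μ, ω ∉ B → ∀ Δ ∈ Ioc 0 Δ₀,
        κ * (|Real.log Δ| * ((m + 1 : ℕ) : ℝ) ^ (1 / (1 + β)))
          ≤ learningTime (overlapRow (fun i => a i ω) m) 0 Δ := by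
  have hβ' : 0 < 1 + β := by linarith
  have hΔ1 : 0 < 1 - Δ₀ := by linarith [hΔ₀.2]
  have hΔ2 : 0 < 2 - Δ₀ := by linarith
  -- `z / 2 / (1 + z / 2) = 1 / (2 - Δ₀) > Δ₀` for `z = 2 / (1 - Δ₀)`
  have hσ : Δ₀ < 1 / (2 - Δ₀) := by
    rw [lt_div_iff₀ hΔ2]; nlinarith [mul_pos hΔ1 hΔ1]
  have hσ1 : 1 / (2 - Δ₀) ≤ 1 := by rw [div_le_one hΔ2]; linarith
  obtain ⟨κ, hκ, hκle⟩ := exists_mul_abs_log_le hΔ₀ hσ hσ1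
  set z := 2 / (1 - Δ₀) with hz
  have hz0 : 0 < z := by positivity
  obtain ⟨K, hK0, hK⟩ : ∃ K : ℝ, 0 < K ∧ max (2 * z) (4 / ε) ≤ c / (4 * (1 + β)) * K ^ (1 + β) := by
    have ht : Tendsto (fun x : ℝ => c / (4 * (1 + β)) * x ^ (1 + β)) atTop atTop :=
      (tendsto_rpow_atTop hβ').const_mul_atTop (by positivity)
    obtain ⟨K, h1, h2⟩ := ((ht.eventually_ge_atTop (max (2 * z) (4 / ε))).and
      (eventually_gt_atTop 0)).exists
    exact ⟨K, h2, h1⟩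
  have hs_top : Tendsto (fun m : ℕ => ((m + 1 : ℕ) : ℝ) ^ (1 / (1 + β))) atTop atTop :=
    (tendsto_rpow_atTop (by positivity)).comp
      (tendsto_natCast_atTop_atTop.comp (tendsto_add_atTop_nat 1))
  obtain ⟨M, hM⟩ := eventually_atTop.mp ((eventually_ge_atTop 1).and
    (hs_top.eventually_ge_atTop (max (K / r) (8 * K / z))))
  refine ⟨z / (8 * K) * κ, by positivity, M, fun m hmM => ?_⟩
  obtain ⟨hm, hsm⟩ := hM m hmM
  set s : ℝ := ((m + 1 : ℕ) : ℝ) ^ (1 / (1 + β)) with hs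
  have hm1 : (1 : ℝ) ≤ m := by exact_mod_cast hm
  have hs0 : 0 < s := Real.rpow_pos_of_pos (by positivity) _
  have hspow : s ^ (1 + β) = m + 1 := by
    rw [hs, ← Real.rpow_mul (by positivity), one_div_mul_cancel hβ'.ne', Real.rpow_one]
    push_cast
    ring
  have hKr : K / s ≤ r := by
    rw [div_le_iff₀ hs0, mul_comm, ← div_le_iff₀ hr]
    exact (le_max_left _ _).trans hsm
  have hb2 : 2 ≤ z * s / (4 * K) := by
    have := (le_max_right _ _).trans hsm
    rw [div_le_iff₀ hz0] at this
    rw [le_div_iff₀ (by positivity)]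
    linarith
  set p := c / (2 * (1 + β)) * (K / s) ^ (1 + β) with hp
  have hmp : max (2 * z) (4 / ε) ≤ m * p := by
    refine hK.trans ?_
    rw [hp, Real.div_rpow hK0.le hs0.le, hspow]
    have h1 : (m : ℝ) * (c / (2 * (1 + β)) * (K ^ (1 + β) / (m + 1)))
        = c / (4 * (1 + β)) * K ^ (1 + β) * (2 * m / (m + 1)) := by field_simp; norm_num
    rw [h1]
    refine le_mul_of_one_le_right (by positivity) ?_
    rw [le_div_iff₀ (by positivity)]
    linarith
  have hmp0 : 0 < m * p := lt_of_lt_of_le (by positivity) ((le_max_left _ _).trans hmp)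
  refine ⟨_, (measure_card_lt_le ha_meas ha_indep (s := K / s) (p := p) (z := z) (m := m)
    (fun i => le_measure_one_sub_le hg (ha_meas i) (ha_law i) hc hβ hb (by positivity) hKr)
    hmp0 ((le_max_left _ _).trans hmp)).trans ?_, ?_⟩
  · rw [div_le_comm₀ hmp0 hε]
    exact (le_max_right _ _).trans hmp
  · filter_upwards [ae_all_iff.mpr fun i => ae_mem_Ico (ha_meas i) hg_supp (ha_law i)] with ω hω hB
      Δ hΔ
    have hZ := not_lt.mp hB
    have h0 : ∀ i < m, 0 ≤ a i ω := fun i _ => (hω i).1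
    have h1 : ∀ i < m, a i ω < 1 := fun i _ => (hω i).2
    set t := 2 * K / s with ht
    have ht0 : 0 < t := by positivity
    have hcard := card_div_le_resolventSum hm h1 ht0
    rw [show t / 2 = K / s by rw [ht]; ring] at hcard
    set R := resolventSum (fun i => a i ω) m t with hR
    have hRz : z / (2 * t) ≤ R := le_trans (by gcongr) hcard
    have hzt : z / (2 * t) = z * s / (4 * K) := by rw [ht]; field_simp; norm_num
    have htR : z / 2 ≤ t * R := by
      have := mul_le_mul_of_nonneg_left hRz ht0.le
      have h2 : t * (z / (2 * t)) = z / 2 := by field_simp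
      linarith
    rw [hzt] at hRz
    have hR1 : 1 < R := by linarith
    have hσR : 1 / (2 - Δ₀) ≤ t * R / (1 + t * R) := by
      rw [div_le_div_iff₀ hΔ2 (by linarith)]
      have h2 : 1 ≤ t * R * (1 - Δ₀) := by
        calc (1 : ℝ) = z / 2 * (1 - Δ₀) := by rw [hz]; field_simp
          _ ≤ _ := by gcongr
      linarith
    have hr : 0 ≤ 1 - 1 / R := by rw [sub_nonneg, div_le_one (by linarith)]; exact hR1.le
    have h := mul_le_learningTime hm h0 h1 (Δ := Δ) ⟨hΔ.1, hΔ.2.trans_lt hΔ₀.2⟩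
      (σ := 1 / (2 - Δ₀)) (b := R) (by positivity) hR1 fun N =>
        (mul_le_mul_of_nonneg_right hσR (pow_nonneg hr N)).trans
          (le_sum_wrongProb hm h0 h1 ht0 hR1.le N)
    refine le_trans ?_ h
    have h3 : z * s / (4 * K) / 2 ≤ R - 1 := by linarith
    calc z / (8 * K) * κ * (|Real.log Δ| * s)
        = z * s / (4 * K) / 2 * (κ * |Real.log Δ|) := by ring
      _ ≤ _ := mul_le_mul h3 (hκle Δ hΔ) (by positivity) (by linarith)

/-- With high probability the learning time is at least of order
`|log Δ| * (m + 1) ^ (1 / (1 + β))`, uniformly in `m` and `Δ`. -/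
lemma exists_le_learningTime (hg : Measurable g)
    (hg_supp : ∀ t, t ∉ Icc (0 : ℝ) 1 → g t = 0) (ha_meas : ∀ i, Measurable (a i))
    (ha_indep : iIndepFun a μ)
    (ha_law : ∀ i, μ.map (a i) = volume.withDensity fun t => ENNReal.ofReal (g t))
    {c β r : ℝ} (hc : 0 < c) (hβ : -1 < β) (hr : 0 < r)
    (hb : ∀ x, 0 < x → x ≤ r → c / 2 * x ^ β ≤ g (1 - x))
    {Δ₀ ε : ℝ} (hΔ₀ : Δ₀ ∈ Ioo (0 : ℝ) 1) (hε : 0 < ε) :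
    ∃ κ : ℝ, 0 < κ ∧ ∀ m : ℕ, 1 / ((m + 1 : ℕ) : ℝ) < 1 - Δ₀ → ∃ B : Set Ω,
      μ.real B ≤ ε ∧ ∀ᵐ ω ∂μ, ω ∉ B → ∀ Δ ∈ Ioc 0 Δ₀,
        κ * (|Real.log Δ| * ((m + 1 : ℕ) : ℝ) ^ (1 / (1 + β)))
          ≤ learningTime (overlapRow (fun i => a i ω) m) 0 Δ := by
  obtain ⟨κ₁, hκ₁, M, hM⟩ := exists_le_learningTime_of_ge hg hg_supp ha_meas ha_indep ha_law hc hβ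
    hr hb hΔ₀ hε
  -- the initial error probability `m / (m + 1)` is smallest for the least admissible `m`
  have hex : ∃ m : ℕ, 1 / ((m + 1 : ℕ) : ℝ) < 1 - Δ₀ := by
    obtain ⟨m, hm⟩ := exists_nat_one_div_lt (show 0 < 1 - Δ₀ by linarith [hΔ₀.2])
    exact ⟨m, by exact_mod_cast hm⟩
  classical
  set m₀ := Nat.find hex
  have hm₀ := Nat.find_spec hex
  have hβ' : 0 < 1 + β := by linarith
  obtain ⟨κ₂, hκ₂, hM₂⟩ := exists_le_learningTime_of_lt hg_supp ha_meas ha_law hΔ₀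
    (θ := 1 - 1 / ((m₀ + 1 : ℕ) : ℝ)) (by linarith) (sub_le_self _ (by positivity))
    (α := 1 / (1 + β)) (by positivity) hε M
  refine ⟨min κ₁ κ₂, lt_min hκ₁ hκ₂, fun m hm => ?_⟩
  rcases le_or_gt M m with hmM | hmM
  · obtain ⟨B, hB, hB2⟩ := hM m hmM
    refine ⟨B, hB, ?_⟩
    filter_upwards [hB2] with ω hω hωB Δ hΔ
    refine le_trans ?_ (hω hωB Δ hΔ)
    gcongr
    exact min_le_left _ _
  · have hm1 : 1 ≤ m := by
      by_contra h
      have h2 : m = 0 := by omega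
      rw [h2] at hm
      norm_num at hm
      linarith [hΔ₀.1]
    have hθ : 1 - 1 / ((m₀ + 1 : ℕ) : ℝ) ≤ (m : ℝ) / (m + 1) := by
      have h1 : (m₀ : ℝ) ≤ m := by exact_mod_cast Nat.find_min' hex hm
      have h2 : (m : ℝ) / (m + 1) = 1 - 1 / (m + 1) := by field_simp; ring
      rw [h2]
      push_cast
      gcongr
    obtain ⟨B, hB, hB2⟩ := hM₂ m hm1 hmM hθ
    refine ⟨B, hB, ?_⟩
    filter_upwards [hB2] with ω hω hωB Δ hΔ
    refine le_trans ?_ (hω hωB Δ hΔ)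
    gcongr
    exact min_le_right _ _

end Random

theorem mainTheorem2 {Ω : Type*} [MeasurableSpace Ω] (μ : Measure Ω) [IsProbabilityMeasure μ]
    -- the overlaps: independent random variables in `[0, 1]` with density `g`
    (g : ℝ → ℝ) (hg_meas : Measurable g) (hg_nonneg : ∀ t, 0 ≤ g t)
    (hg_supp : ∀ t, t ∉ Icc (0 : ℝ) 1 → g t = 0)
    (a : ℕ → Ω → ℝ) (ha_meas : ∀ i, Measurable (a i)) (ha_indep : iIndepFun a μ)
    (ha_law : ∀ i, μ.map (a i) = volume.withDensity fun t => ENNReal.ofReal (g t))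
    -- `f x = g (1 - x)` satisfies `f x = c x ^ β + O(x ^ (β + δ))` as `x → 0+`
    (c β δ : ℝ) (hc : 0 < c) (hδ : 0 < δ)
    (hf : (fun x : ℝ => g (1 - x) - c * x ^ β) =O[𝓝[>] 0] fun x : ℝ => x ^ (β + δ)) :
    -- there are `n = m + 1` concepts
    (0 < β →
      ∃ C₁ C₂ : ℝ, 0 < C₁ ∧ 0 < C₂ ∧ ∀ Δ₀ ∈ Ioo (0 : ℝ) 1,
        TendstoUniformlyOn
          (fun (m : ℕ) (Δ : ℝ) => μ.real {ω |
            (learningTime (overlapRow (fun i => a i ω) m) 0 Δ : ℝ) /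
              (|Real.log Δ| * ((m + 1 : ℕ) : ℝ)) ∈ Ioo C₁ C₂})
          (fun _ => 1) atTop (Ioc 0 Δ₀)) ∧
    (-1 < β → β < 0 →
      ∀ Δ₀ ∈ Ioo (0 : ℝ) 1,
        TendstoUniformlyOn
          (fun (x : ℝ) (p : ℕ × ℝ) => μ.real {ω |
            (learningTime (overlapRow (fun i => a i ω) p.1) 0 p.2 : ℝ) /
              (|Real.log p.2| * ((p.1 + 1 : ℕ) : ℝ) ^ (1 / (1 + β))) ∈ Ioo (1 / x) x})
          (fun _ => 1) atTop
          {p : ℕ × ℝ | 1 / ((p.1 + 1 : ℕ) : ℝ) < 1 - Δ₀ ∧ p.2 ∈ Ioc 0 Δ₀}) := by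
  have hmap : ∀ i, μ.map (a i) = μ.map (a 0) := fun i => by rw [ha_law, ha_law]
  obtain ⟨r, hr, hb⟩ := exists_density_bounds hc hδ hf
  have hae : ∀ᵐ ω ∂μ, ∀ i, 0 ≤ a i ω ∧ a i ω < 1 :=
    ae_all_iff.mpr fun i => ae_mem_Ico (ha_meas i) hg_supp (ha_law i)
  refine ⟨fun hβ => ?_, fun hβ hβ0 Δ₀ hΔ₀ => ?_⟩
  · have hint := integrable_one_div_one_sub hg_meas (ha_meas 0) hg_nonneg hg_supp (ha_law 0) hc hβ
      hr fun x hx hxr => (hb x hx hxr).2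
    have hlim := tendsto_measure_sum_one_div_gt ha_meas ha_indep hmap hint
    have hE : 0 ≤ ∫ ω, 1 / (1 - a 0 ω) ∂μ := by
      refine integral_nonneg_of_ae ?_
      filter_upwards [hae] with ω hω
      exact one_div_nonneg.mpr (by linarith [(hω 0).2])
    set E := ∫ ω, 1 / (1 - a 0 ω) ∂μ
    refine ⟨1 / 4, 2 * (E + 1) + 1, by norm_num, by linarith, fun Δ₀ hΔ₀ => ?_⟩
    rw [Metric.tendstoUniformlyOn_iff]
    intro ε hε
    filter_upwards [hlim.eventually_lt_const hε, eventually_ge_atTop 3,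
      tendsto_natCast_atTop_atTop.eventually_gt_atTop (4 / |Real.log Δ₀|)] with m hmε hm3 hmΔ Δ hΔ
    refine (dist_one_measureReal_le ?_).trans_lt hmε
    filter_upwards [hae] with ω hω hωB
    exact learningTime_div_mem_Ioo (fun i _ => (hω i).1) (fun i _ => (hω i).2) hΔ₀ hΔ hm3 hmΔ
      (by linarith) (not_lt.mp hωB)
  · rw [Metric.tendstoUniformlyOn_iff]
    intro ε hε
    obtain ⟨κ, hκ, hlow⟩ := exists_le_learningTime hg_meas hg_supp ha_meas ha_indep ha_law hc hβ hr
      (fun x hx hxr => (hb x hx hxr).1) hΔ₀ (show 0 < ε / 3 by positivity)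
    obtain ⟨A, hA, hup⟩ := exists_measure_sum_one_div_gt_le hg_meas hg_nonneg hg_supp ha_meas
      ha_law hc hβ hβ0 hr (fun x hx hxr => (hb x hx hxr).2) (show 0 < ε / 3 by positivity)
    have hl : 0 < |Real.log Δ₀| := abs_pos.mpr (Real.log_neg hΔ₀.1 hΔ₀.2).ne
    filter_upwards [eventually_gt_atTop (1 / κ), eventually_gt_atTop (2 * A + 1 / |Real.log Δ₀|)]
      with x hxκ hxA
    rintro ⟨m, Δ⟩ ⟨hm, hΔ⟩
    obtain ⟨B, hB, hBlow⟩ := hlow m hm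
    have hm1 : 1 ≤ m := by
      by_contra h
      have h2 : m = 0 := by omega
      simp only [h2] at hm
      norm_num at hm
      linarith [hΔ₀.1]
    set s : ℝ := ((m + 1 : ℕ) : ℝ) ^ (1 / (1 + β)) with hs
    have hs1 : 1 ≤ s := Real.one_le_rpow (by exact_mod_cast Nat.le_add_left 1 m)
      (one_div_nonneg.mpr (by linarith))
    refine (dist_one_measureReal_le (B := B ∪ {ω | A * s
      < ∑ i ∈ Finset.range m, 1 / (1 - a i ω)}) ?_).trans_lt
      (((measureReal_union_le _ _).trans (add_le_add hB (hup m))).trans_lt (by linarith))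
    filter_upwards [hae, hBlow] with ω hω hωlow hωB
    simp only [mem_union, not_or] at hωB
    have hW : ∑ i ∈ Finset.range m, 1 / (1 - a i ω) ≤ A * s := not_lt.mp hωB.2
    have h1 := hωlow hωB.1 Δ hΔ
    have h2 := learningTime_le hm1 (fun i _ => (hω i).1) (fun i _ => (hω i).2) (Δ := Δ)
      ⟨hΔ.1, hΔ.2.trans_lt hΔ₀.2⟩
    have hlΔ := abs_log_le_abs_log hΔ₀.2 hΔ
    set l := |Real.log Δ| with hldef
    have hl0 : 0 < l := hl.trans_le hlΔ
    have hn : 0 < l * s := by positivity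
    change _ / (l * s) ∈ Ioo (1 / x) x
    constructor
    · rw [lt_div_iff₀ hn]
      refine lt_of_lt_of_le ?_ h1
      have : 1 / x < κ := (one_div_lt hκ ((one_div_pos.mpr hκ).trans hxκ)).mp hxκ
      gcongr
    · rw [div_lt_iff₀ hn]
      refine h2.trans_lt ?_
      have h3 : 2 * (∑ i ∈ Finset.range m, 1 / (1 - a i ω)) * l ≤ 2 * (A * s) * l := by gcongr
      have h4 : 1 ≤ 1 / |Real.log Δ₀| * (l * s) := by
        rw [one_div_mul_eq_div, one_le_div hl]
        nlinarith
      have h5 := mul_lt_mul_of_pos_right hxA hn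
      nlinarith
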